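/- For real $\nu>0$ let $J_\nu(x)=\sum_{n\ge 0}\frac{(-1)^n}{n!\,\Gamma(n+\nu+1)}\left(\frac{x}{2}\right)^{2n+\nu}$ $(x>0)$ be the Bessel function of the first kind of order $\nu$. It has infinitely many positive zeros, which can be listed as $0<j_{\nu,1}<j_{\nu,2}<\cdots$, where $j_{\nu,1}$ is the smallest positive zero and $j_{\nu,k+1}$ is the smallest zero larger than $j_{\nu,k}$. Put $E_k(\nu)=j_{\nu,k}^2$. Then for all real $\nu_2>\nu>\nu_1>0$ and every positive integer $m$, $$\sum_{k=1}^m\bigl(E_k(\nu_2)-E_k(\nu)\bigr)\;\le\;\frac{\nu_2^2-\nu^2}{\nu^2-\nu_1^2}\,\sum_{k=1}^m\bigl(E_k(\nu)-E_k(\nu_1)\bigr).$$ -/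

import Mathlib

/-- The Bessel function of the first kind `J_ν(x)` of real order `ν`, for `x > 0`, by its power
series `∑ₙ (-1)ⁿ / (n! Γ(n + ν + 1)) (x / 2) ^ (2 n + ν)`. -/
noncomputable def besselJ (ν x : ℝ) : ℝ :=
  ∑' n : ℕ, (-1 : ℝ) ^ n / ((n.factorial : ℝ) * Real.Gamma ((n : ℝ) + ν + 1)) *
    (x / 2) ^ (2 * (n : ℝ) + ν)

/-- For `k ≥ 1`, the `k`-th positive zero `j_{ν,k}` of `J_ν` in increasing order: the first
zero beyond `j_{ν,k-1}`, where the auxiliary starting value is `j_{ν,0} = 0`. -/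
noncomputable def besselZero (ν : ℝ) : ℕ → ℝ
  | 0 => 0
  | k + 1 => sInf {x : ℝ | besselZero ν k < x ∧ besselJ ν x = 0}

/-- `E_k(ν) = j_{ν,k}²`. -/
noncomputable def besselE (k : ℕ) (ν : ℝ) : ℝ :=
  besselZero ν k ^ 2

open Filter Topology

/-! With `y = x² / 4` as variable, Bessel's equation becomes the eigenvalue problem `-(y f')' + (ν /
2)² / y * f = t f` on `(0, 1]` with `f(1) = 0`. Its eigenvalues are `τ_k(ν) = j_{ν,k}² / 4`, with
eigenfunctions proportional to `J_ν(2 √(τ_k y))`. The operator is affine in `ν²`, and the sum of its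
`m` lowest eigenvalues is the minimum of its trace over `m`-dimensional trial spaces. That sum is
therefore a concave function of `ν²`, and the theorem compares its slopes on two adjacent intervals.

Only one inequality is needed: the first `m` eigenfunctions of order `ν`, used as trial space for
order `μ`, give `∑ τ_k(μ) ≤ ∑ τ_k(ν) + (μ² - ν²) / 4 * ∑ ∫ u_k² / y` (`sum_besselT_le_trace`). No
spectral theory of the operator enters. If a trial function vanishes at the interior nodes of an
eigenfunction of order `μ`, Picone's identity on each nodal interval bounds its form below by that
eigenvalue (`picone_unit_interval`). The `j`-th lowest node count imposes `j` linear conditions,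
counting from zero, so finite-dimensional min-max (`sum_le_trace_of_minmax`) finishes the argument.
-/

/-! ### The entire factor of the Bessel function. -/

/-- The coefficients of the entire function `besselG`. -/
noncomputable def besselCoeff (ν : ℝ) (n : ℕ) : ℝ :=
  (-1 : ℝ) ^ n / ((n.factorial : ℝ) * Real.Gamma ((n : ℝ) + ν + 1))

/-- The entire function `g` with `J_ν(x) = (x / 2) ^ ν * g (x² / 4)`. -/
noncomputable def besselG (ν t : ℝ) : ℝ := ∑' n : ℕ, besselCoeff ν n * t ^ n

lemma gamma_le_gamma_nat_add {ν : ℝ} (hν : 0 < ν) (n : ℕ) :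
    Real.Gamma (ν + 1) ≤ Real.Gamma ((n : ℝ) + ν + 1) := by
  induction n with
  | zero => simp
  | succ n ih =>
    have h0 : (0 : ℝ) ≤ n := n.cast_nonneg
    have h1 : Real.Gamma ((n : ℝ) + ν + 1 + 1) =
        ((n : ℝ) + ν + 1) * Real.Gamma ((n : ℝ) + ν + 1) :=
      Real.Gamma_add_one (by positivity)
    have h2 : 0 < Real.Gamma ((n : ℝ) + ν + 1) := Real.Gamma_pos_of_pos (by positivity)
    have h3 : ((n + 1 : ℕ) : ℝ) + ν + 1 = (n : ℝ) + ν + 1 + 1 := by push_cast; ring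
    rw [h3, h1]
    nlinarith

lemma abs_besselCoeff_le {ν : ℝ} (hν : 0 < ν) (n : ℕ) :
    |besselCoeff ν n| ≤ (Real.Gamma (ν + 1))⁻¹ * (n.factorial : ℝ)⁻¹ := by
  have h2 : 0 < Real.Gamma (ν + 1) := Real.Gamma_pos_of_pos (by positivity)
  have h4 := gamma_le_gamma_nat_add hν n
  have h3 : 0 < Real.Gamma ((n : ℝ) + ν + 1) := h2.trans_le h4
  have h5 : (0 : ℝ) < n.factorial := by positivity
  rw [besselCoeff, abs_div, abs_pow, abs_neg, abs_one, one_pow,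
    abs_of_pos (mul_pos h5 h3), one_div, mul_inv, mul_comm]
  gcongr

lemma summable_abs_besselCoeff {ν : ℝ} (hν : 0 < ν) (t : ℝ) :
    Summable fun n : ℕ ↦ |besselCoeff ν n| * |t| ^ n := by
  refine Summable.of_nonneg_of_le (fun n ↦ by positivity) (fun n ↦ ?_)
    ((Real.summable_pow_div_factorial |t|).mul_left (Real.Gamma (ν + 1))⁻¹)
  calc |besselCoeff ν n| * |t| ^ n
      ≤ ((Real.Gamma (ν + 1))⁻¹ * (n.factorial : ℝ)⁻¹) * |t| ^ n := by
        gcongr; exact abs_besselCoeff_le hν n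
    _ = _ := by ring

lemma summable_besselCoeff {ν : ℝ} (hν : 0 < ν) (t : ℝ) :
    Summable fun n : ℕ ↦ besselCoeff ν n * t ^ n :=
  Summable.of_abs <| by simpa [abs_mul, abs_pow] using summable_abs_besselCoeff hν t

lemma besselCoeff_succ {ν : ℝ} (n : ℕ) :
    ((n + 1 : ℕ) : ℝ) * besselCoeff ν (n + 1) = -besselCoeff (ν + 1) n := by
  have h : ((n + 1 : ℕ) : ℝ) + ν + 1 = (n : ℝ) + (ν + 1) + 1 := by push_cast; ring
  have h5 : (n.factorial : ℝ) ≠ 0 := by positivity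
  have h6 : ((n : ℝ) + 1) ≠ 0 := by positivity
  rw [besselCoeff, besselCoeff, h, Nat.factorial_succ]
  generalize Real.Gamma ((n : ℝ) + (ν + 1) + 1) = G
  push_cast
  rw [pow_succ, mul_assoc, ← mul_div_assoc, mul_div_mul_left _ _ h6]
  ring

lemma hasDerivAt_besselG {ν : ℝ} (hν : 0 < ν) (t : ℝ) :
    HasDerivAt (besselG ν) (-besselG (ν + 1) t) t := by
  have key : ∀ n : ℕ, ∀ s : ℝ, ((n + 1 : ℕ) : ℝ) * s ^ n * besselCoeff ν (n + 1) =
      -(besselCoeff (ν + 1) n * s ^ n) := fun n s ↦ by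
    linear_combination s ^ n * besselCoeff_succ (ν := ν) n
  have hsum : Summable fun n : ℕ ↦ |besselCoeff ν n| * (n * (|t| + 1) ^ (n - 1)) := by
    rw [← summable_nat_add_iff 1]
    refine (summable_abs_besselCoeff (ν := ν + 1) (by positivity) (|t| + 1)).congr fun n ↦ ?_
    rw [abs_of_nonneg (show (0 : ℝ) ≤ |t| + 1 by positivity), ← abs_neg (besselCoeff (ν + 1) n),
      ← besselCoeff_succ, abs_mul, Nat.abs_cast, Nat.add_sub_cancel]
    ring
  have h := hasDerivAt_tsum_of_isPreconnected (g := fun (n : ℕ) (s : ℝ) ↦ besselCoeff ν n * s ^ n)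
    (g' := fun (n : ℕ) (s : ℝ) ↦ besselCoeff ν n * (n * s ^ (n - 1)))
    (t := Metric.ball (0 : ℝ) (|t| + 1)) (y₀ := 0) (y := t) hsum Metric.isOpen_ball
    (convex_ball _ _).isPreconnected
    (fun n y _ ↦ (hasDerivAt_pow n y).const_mul _)
    (fun n y hy ↦ by
      have hy' : |y| ≤ |t| + 1 := by simpa using (mem_ball_zero_iff.1 hy).le
      rw [Real.norm_eq_abs, abs_mul, abs_mul, abs_pow, Nat.abs_cast]
      gcongr)
    (by simpa using by positivity) (summable_besselCoeff hν 0) (by simp)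
  refine h.congr_deriv ?_
  have hs : Summable fun n : ℕ ↦ besselCoeff ν n * (n * t ^ (n - 1)) := by
    refine Summable.of_norm_bounded hsum fun n ↦ ?_
    rw [Real.norm_eq_abs, abs_mul, abs_mul, abs_pow, Nat.abs_cast]
    gcongr
    linarith
  rw [hs.tsum_eq_zero_add, besselG, ← tsum_neg]
  simp only [Nat.cast_zero, zero_mul, mul_zero, zero_add]
  refine tsum_congr fun n ↦ ?_
  rw [← key, Nat.add_sub_cancel]; ring

/-- Since `g_ν' = -g_{ν+1}`, this is Bessel's equation `t g'' + (ν + 1) g' + g = 0`. On coefficients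
it comes from `Γ(s + 1) = s Γ(s)`. -/
lemma besselG_recurrence {ν : ℝ} (hν : 0 < ν) (t : ℝ) :
    t * besselG (ν + 2) t - (ν + 1) * besselG (ν + 1) t + besselG ν t = 0 := by
  have h0 := summable_besselCoeff hν t
  have h1 := summable_besselCoeff (ν := ν + 1) (by positivity) t
  have h2 := summable_besselCoeff (ν := ν + 2) (by positivity) t
  have c0 : ∀ n : ℕ, besselCoeff ν n = ((n : ℝ) + ν + 1) * besselCoeff (ν + 1) n := fun n ↦ by
    have h0 : (0 : ℝ) ≤ n := n.cast_nonneg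
    have h1 : Real.Gamma ((n : ℝ) + (ν + 1) + 1) =
        ((n : ℝ) + ν + 1) * Real.Gamma ((n : ℝ) + ν + 1) := by
      rw [← add_assoc]; exact Real.Gamma_add_one (by positivity)
    have h2 : 0 < Real.Gamma ((n : ℝ) + ν + 1) := Real.Gamma_pos_of_pos (by positivity)
    have h3 : 0 < (n : ℝ) + ν + 1 := by positivity
    rw [besselCoeff, besselCoeff, h1]
    field_simp
  have h3 : besselG ν t - (ν + 1) * besselG (ν + 1) t =
      ∑' n : ℕ, (n : ℝ) * besselCoeff (ν + 1) n * t ^ n := by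
    rw [besselG, besselG, ← tsum_mul_left, ← h0.tsum_sub (h1.mul_left _)]
    exact tsum_congr fun n ↦ by rw [c0]; ring
  have h4 : Summable fun n : ℕ ↦ (n : ℝ) * besselCoeff (ν + 1) n * t ^ n :=
    (h0.sub (h1.mul_left (ν + 1))).congr fun n ↦ by rw [c0]; ring
  have h5 : ∑' n : ℕ, (n : ℝ) * besselCoeff (ν + 1) n * t ^ n = -(t * besselG (ν + 2) t) := by
    rw [h4.tsum_eq_zero_add, besselG, ← tsum_mul_left, ← tsum_neg]
    simp only [Nat.cast_zero, zero_mul, zero_add]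
    refine tsum_congr fun n ↦ ?_
    rw [besselCoeff_succ, show ν + 1 + 1 = ν + 2 by ring]; ring
  linarith

lemma besselG_zero_pos {ν : ℝ} (hν : 0 < ν) : 0 < besselG ν 0 := by
  have : besselG ν 0 = (Real.Gamma (ν + 1))⁻¹ := by
    rw [besselG, tsum_eq_single 0 (fun n hn ↦ by simp [hn])]
    simp [besselCoeff]
  rw [this]
  exact inv_pos.2 (Real.Gamma_pos_of_pos (by positivity))

lemma continuous_besselG {ν : ℝ} (hν : 0 < ν) : Continuous (besselG ν) :=
  continuous_iff_continuousAt.2 fun t ↦ (hasDerivAt_besselG hν t).continuousAt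

lemma besselJ_eq {ν x : ℝ} (hx : 0 < x) :
    besselJ ν x = (x / 2) ^ ν * besselG ν ((x / 2) ^ 2) := by
  rw [besselJ, besselG, ← tsum_mul_left]
  refine tsum_congr fun n ↦ ?_
  have : (x / 2) ^ (2 * (n : ℝ) + ν) = (x / 2) ^ ν * ((x / 2) ^ 2) ^ n := by
    rw [Real.rpow_add (by positivity), ← pow_mul, ← Real.rpow_natCast]
    push_cast; ring
  rw [this, besselCoeff]; ring

lemma besselJ_eq_zero_iff {ν x : ℝ} (hx : 0 < x) :
    besselJ ν x = 0 ↔ besselG ν ((x / 2) ^ 2) = 0 := by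
  rw [besselJ_eq hx, mul_eq_zero, or_iff_right (Real.rpow_pos_of_pos (by positivity) _).ne']

/-! ### The Sturm–Liouville form of Bessel's equation. -/

/-- The solution `y ^ (ν / 2) * g (t y)` of `(y f')' = ((ν / 2)² / y - t) f`. -/
noncomputable def besselF (ν t y : ℝ) : ℝ := y ^ (ν / 2) * besselG ν (t * y)

/-- The quasi-derivative `y f'` of `f = besselF ν t`. -/
noncomputable def besselP (ν t y : ℝ) : ℝ :=
  y ^ (ν / 2) * (ν / 2 * besselG ν (t * y) - t * y * besselG (ν + 1) (t * y))

lemma hasDerivAt_besselF {ν t y : ℝ} (hν : 0 < ν) (hy : 0 < y) :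
    HasDerivAt (besselF ν t) (besselP ν t y / y) y := by
  have h1 := (hasDerivAt_besselG hν (t * y)).comp y ((hasDerivAt_id y).const_mul t)
  have h2 := (Real.hasDerivAt_rpow_const (x := y) (p := ν / 2) (Or.inl hy.ne')).mul h1
  refine h2.congr_deriv ?_
  rw [Real.rpow_sub_one hy.ne', besselP]
  simp only [Function.comp]
  field_simp
  ring

lemma hasDerivAt_besselP {ν t y : ℝ} (hν : 0 < ν) (hy : 0 < y) :
    HasDerivAt (besselP ν t) (((ν / 2) ^ 2 / y - t) * besselF ν t y) y := by
  have hl := (hasDerivAt_id y).const_mul t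
  have h1 := (hasDerivAt_besselG hν (t * y)).comp y hl
  have h3 := (hasDerivAt_besselG (ν := ν + 1) (by positivity) (t * y)).comp y hl
  have h2 := (Real.hasDerivAt_rpow_const (x := y) (p := ν / 2) (Or.inl hy.ne')).mul
    ((h1.const_mul (ν / 2)).sub (hl.mul h3))
  refine h2.congr_deriv ?_
  have hr := besselG_recurrence hν (t * y)
  rw [show ν + 1 + 1 = ν + 2 by ring, Real.rpow_sub_one hy.ne', besselF]
  simp only [Function.comp, id, Pi.mul_apply, Pi.sub_apply]
  generalize besselG ν (t * y) = A at hr ⊢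
  generalize besselG (ν + 1) (t * y) = B at hr ⊢
  generalize besselG (ν + 2) (t * y) = C at hr ⊢
  field_simp
  linear_combination (4 * t * y) * hr

lemma continuous_besselF {ν : ℝ} (hν : 0 < ν) (t : ℝ) : Continuous (besselF ν t) :=
  (Real.continuous_rpow_const (by positivity)).mul
    ((continuous_besselG hν).comp (continuous_const.mul continuous_id))

lemma continuous_besselP {ν : ℝ} (hν : 0 < ν) (t : ℝ) : Continuous (besselP ν t) := by
  have h1 := continuous_besselG hν
  have h2 := continuous_besselG (ν := ν + 1) (by positivity)
  have h3 := Real.continuous_rpow_const (q := ν / 2) (by positivity)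
  unfold besselP
  fun_prop

lemma besselF_eq_zero_iff {ν t y : ℝ} (hy : 0 < y) : besselF ν t y = 0 ↔ besselG ν (t * y) = 0 := by
  rw [besselF, mul_eq_zero, or_iff_right (Real.rpow_pos_of_pos hy _).ne']

lemma besselF_apply_zero {ν : ℝ} (hν : 0 < ν) (t : ℝ) : besselF ν t 0 = 0 := by
  rw [besselF, Real.zero_rpow (by positivity), zero_mul]

lemma besselP_apply_zero {ν : ℝ} (hν : 0 < ν) (t : ℝ) : besselP ν t 0 = 0 := by
  rw [besselP, Real.zero_rpow (by positivity), zero_mul]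

lemma eventually_besselF_ne_zero_nhdsGT_zero {ν : ℝ} (hν : 0 < ν) (t : ℝ) :
    ∀ᶠ y in 𝓝[>] 0, besselF ν t y ≠ 0 := by
  have hc : Continuous fun y ↦ besselG ν (t * y) :=
    (continuous_besselG hν).comp (continuous_const.mul continuous_id)
  have h : ∀ᶠ y in 𝓝 (0 : ℝ), besselG ν (t * y) ≠ 0 :=
    hc.continuousAt.eventually_ne (by simpa using (besselG_zero_pos hν).ne')
  filter_upwards [h.filter_mono nhdsWithin_le_nhds, self_mem_nhdsWithin] with y hy hy0
  rwa [Ne, besselF_eq_zero_iff hy0]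

/-- The positive zeros of `besselF` are simple. -/
lemma besselP_ne_zero {ν t z : ℝ} (hν : 0 < ν) (ht : 0 < t) (hz : 0 < z)
    (h : besselF ν t z = 0) : besselP ν t z ≠ 0 := by
  intro hp
  -- An energy with `N' = t f² ≥ 0` and `N 0 = 0`. A double zero at `z` gives `N z = 0`, so `N` and
  -- hence `f` vanish on `(0, z)`, against `g_ν(0) > 0`.
  set N : ℝ → ℝ := fun y ↦ besselP ν t y ^ 2 + (t * y - (ν / 2) ^ 2) * besselF ν t y ^ 2 with hN
  have hcont : Continuous N := by
    have := continuous_besselF hν t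
    have := continuous_besselP hν t
    fun_prop
  have hderiv : ∀ y, 0 < y → HasDerivAt N (t * besselF ν t y ^ 2) y := fun y hy ↦ by
    have h1 := ((hasDerivAt_besselP (t := t) hν hy).pow 2).add
      ((((hasDerivAt_id y).const_mul t).sub_const ((ν / 2) ^ 2)).mul
        ((hasDerivAt_besselF (t := t) hν hy).pow 2))
    refine h1.congr_deriv ?_
    simp only [id, Pi.pow_apply]
    generalize besselF ν t y = A
    generalize besselP ν t y = B
    field_simp
    ring
  have hmono : MonotoneOn N (Set.Ici 0) := by
    refine monotoneOn_of_deriv_nonneg (convex_Ici 0) hcont.continuousOn ?_ ?_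
    · rw [interior_Ici]
      exact fun y hy ↦ (hderiv y hy).differentiableAt.differentiableWithinAt
    · rw [interior_Ici]
      intro y hy
      rw [(hderiv y hy).deriv]
      positivity
  have hN0 : N 0 = 0 := by simp [hN, besselF_apply_zero hν, besselP_apply_zero hν]
  have hNz : N z = 0 := by simp [hN, h, hp]
  have hzero : ∀ y ∈ Set.Ioo 0 z, besselF ν t y = 0 := fun y hy ↦ by
    have hev : N =ᶠ[𝓝 y] fun _ ↦ 0 := by
      filter_upwards [Ioo_mem_nhds hy.1 hy.2] with x hx
      exact le_antisymm (hNz ▸ hmono hx.1.le hz.le hx.2.le)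
        (hN0 ▸ hmono Set.self_mem_Ici hx.1.le hx.1.le)
    have h1 := (hderiv y hy.1).unique ((hasDerivAt_const y (0 : ℝ)).congr_of_eventuallyEq hev)
    simpa [ht.ne'] using h1
  obtain ⟨y, hy, hy'⟩ := ((eventually_besselF_ne_zero_nhdsGT_zero hν t).and
    (Ioo_mem_nhdsGT hz)).exists
  exact hy (hzero y hy')

/-! ### Oscillation: zeros beyond every bound. -/

/-- A solution of `y f' = p`, `p' = (c / y - 1) f` cannot stay positive. -/
lemma not_eventually_pos_of_system {f p : ℝ → ℝ} {c Y : ℝ}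
    (hf : ∀ y, Y < y → HasDerivAt f (p y / y) y)
    (hp : ∀ y, Y < y → HasDerivAt p ((c / y - 1) * f y) y)
    (hpos : ∀ y, Y < y → 0 < f y) : False := by
  -- Beyond `2 * c` the factor `c / y - 1` is at most `-1 / 2`, so `p` decreases there.
  obtain ⟨X, hX1, hXY, hXc⟩ : ∃ X : ℝ, 1 ≤ X ∧ Y < X ∧ 2 * c ≤ X :=
    ⟨max 1 (max (Y + 1) (2 * c)), le_max_left _ _,
      (lt_add_one Y).trans_le ((le_max_left _ _).trans (le_max_right _ _)),
      (le_max_right _ _).trans (le_max_right _ _)⟩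
  have hp' : ∀ y, X ≤ y → (c / y - 1) * f y ≤ -(f y / 2) := fun y hy ↦ by
    have hy0 : 0 < y := by linarith
    have h1 : c / y ≤ 1 / 2 := by rw [div_le_iff₀ hy0]; linarith
    nlinarith [hpos y (hXY.trans_le hy)]
  have anti : ∀ {Z : ℝ} {h h' : ℝ → ℝ}, (∀ y, Z ≤ y → HasDerivAt h (h' y) y) →
      (∀ y, Z ≤ y → h' y ≤ 0) → AntitoneOn h (Set.Ici Z) := fun {Z h h'} h1 h2 ↦ by
    refine antitoneOn_of_deriv_nonpos (convex_Ici Z)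
      (fun y hy ↦ (h1 y hy).continuousAt.continuousWithinAt) ?_ ?_
    · intro y hy
      exact (h1 y (interior_subset hy)).differentiableAt.differentiableWithinAt
    · intro y hy
      rw [(h1 y (interior_subset hy)).deriv]
      exact h2 y (interior_subset hy)
  have hpanti : AntitoneOn p (Set.Ici X) :=
    anti (fun y hy ↦ hp y (hXY.trans_le hy))
      fun y hy ↦ (hp' y hy).trans (by have := hpos y (hXY.trans_le hy); linarith)
  -- Once `p` is negative, `f' ≤ p Z / y` drives `f` to `-∞` like a logarithm. If `p` stays
  -- nonnegative, `f` increases, so `p' ≤ -f X / 2` drives `p` to `-∞`.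
  by_cases hneg : ∃ y, X ≤ y ∧ p y < 0
  · obtain ⟨Z, hZX, hpZ⟩ := hneg
    have hZ0 : 0 < Z := by linarith
    have h1 : AntitoneOn (fun y ↦ f y - p Z * Real.log y) (Set.Ici Z) := by
      refine anti (h' := fun y ↦ p y / y - p Z * y⁻¹) (fun y hy ↦ ?_) (fun y hy ↦ ?_)
      · exact (hf y (hXY.trans_le (hZX.trans hy))).sub
          ((Real.hasDerivAt_log (hZ0.trans_le hy).ne').const_mul _)
      · have h2 := hpanti hZX (hZX.trans hy) hy
        have : 0 < y⁻¹ := inv_pos.2 (hZ0.trans_le hy)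
        rw [div_eq_mul_inv, ← sub_mul]
        nlinarith
    have h2 : Tendsto (fun y ↦ p Z * Real.log y) atTop atBot :=
      Real.tendsto_log_atTop.const_mul_atTop_of_neg hpZ
    obtain ⟨y, hy1, hy2⟩ := ((h2.eventually_le_atBot (-(f Z - p Z * Real.log Z))).and
      (eventually_ge_atTop Z)).exists
    have h3 : f y - p Z * Real.log y ≤ f Z - p Z * Real.log Z := h1 Set.self_mem_Ici hy2 hy2
    have := hpos y (hXY.trans_le (hZX.trans hy2))
    linarith
  · push Not at hneg
    have hfmono : ∀ y, X ≤ y → f X ≤ f y := fun y hy ↦ by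
      have h1 : AntitoneOn (fun y ↦ -f y) (Set.Ici X) := by
        refine anti (h' := fun y ↦ -(p y / y)) (fun y hy ↦ (hf y (hXY.trans_le hy)).neg)
          (fun y hy ↦ ?_)
        have := div_nonneg (hneg y hy) (show (0 : ℝ) ≤ y by linarith)
        linarith
      have h2 : -f y ≤ -f X := h1 Set.self_mem_Ici hy hy
      linarith
    have h1 : AntitoneOn (fun y ↦ p y - -(f X / 2) * y) (Set.Ici X) := by
      refine anti (h' := fun y ↦ (c / y - 1) * f y - -(f X / 2) * 1) (fun y hy ↦ ?_)
        (fun y hy ↦ ?_)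
      · exact (hp y (hXY.trans_le hy)).sub ((hasDerivAt_id y).const_mul _)
      · have := hp' y hy
        have := hfmono y hy
        linarith
    have hfX := hpos X hXY
    have h2 : Tendsto (fun y ↦ -(f X / 2) * y) atTop atBot :=
      tendsto_id.const_mul_atTop_of_neg (by linarith)
    obtain ⟨y, hy1, hy2⟩ := ((h2.eventually_lt_atBot (-(p X - -(f X / 2) * X))).and
      (eventually_ge_atTop X)).exists
    have h3 : p y - -(f X / 2) * y ≤ p X - -(f X / 2) * X := h1 Set.self_mem_Ici hy2 hy2
    have := hneg y hy2
    linarith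

lemma exists_besselF_eq_zero {ν : ℝ} (hν : 0 < ν) (Y : ℝ) : ∃ y, Y < y ∧ besselF ν 1 y = 0 := by
  wlog hY : 0 ≤ Y generalizing Y
  · obtain ⟨y, hy, h⟩ := this 0 le_rfl
    exact ⟨y, (not_le.1 hY).trans hy, h⟩
  by_contra! hne
  have hf : ∀ y, Y < y → HasDerivAt (besselF ν 1) (besselP ν 1 y / y) y :=
    fun y hy ↦ hasDerivAt_besselF hν (hY.trans_lt hy)
  have hp : ∀ y, Y < y →
      HasDerivAt (besselP ν 1) (((ν / 2) ^ 2 / y - 1) * besselF ν 1 y) y :=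
    fun y hy ↦ hasDerivAt_besselP hν (hY.trans_lt hy)
  have hsign : (∀ y ∈ Set.Ioi Y, 0 < besselF ν 1 y) ∨ ∀ y ∈ Set.Ioi Y, besselF ν 1 y < 0 := by
    by_contra! hcon
    obtain ⟨⟨a, ha, ha'⟩, b, hb, hb'⟩ := hcon
    obtain ⟨y, hy, hy'⟩ := isPreconnected_Ioi.intermediate_value ha hb
      (continuous_besselF hν 1).continuousOn ⟨ha', hb'⟩
    exact hne y hy hy'
  rcases hsign with h | h
  · exact not_eventually_pos_of_system hf hp h
  · refine not_eventually_pos_of_system (f := fun y ↦ -besselF ν 1 y)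
      (p := fun y ↦ -besselP ν 1 y) (c := (ν / 2) ^ 2) (Y := Y)
      (fun y hy ↦ (hf y hy).neg.congr_deriv (by ring))
      (fun y hy ↦ (hp y hy).neg.congr_deriv (by ring)) (fun y hy ↦ neg_pos.2 (h y hy))

/-! ### The ordered sequence of positive zeros. -/

lemma besselJ_eq_besselF {ν x : ℝ} (hx : 0 < x) : besselJ ν x = besselF ν 1 ((x / 2) ^ 2) := by
  rw [besselJ_eq hx, besselF, one_mul, ← Real.rpow_natCast, ← Real.rpow_mul (by positivity)]
  congr 2
  push_cast; ring

lemma eventually_besselF_ne_zero {ν a : ℝ} (hν : 0 < ν) (ha : 0 ≤ a) :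
    ∀ᶠ y in 𝓝[>] a, besselF ν 1 y ≠ 0 := by
  rcases ha.eq_or_lt with rfl | ha
  · exact eventually_besselF_ne_zero_nhdsGT_zero hν 1
  by_cases h : besselF ν 1 a = 0
  · exact ((hasDerivAt_besselF hν ha).eventually_ne
      (div_ne_zero (besselP_ne_zero hν one_pos ha h) ha.ne')).filter_mono
      (nhdsWithin_mono _ fun y hy ↦ ne_of_gt hy)
  · exact ((continuous_besselF hν 1).continuousAt.eventually_ne h).filter_mono nhdsWithin_le_nhds

/-- Zeros do not accumulate at `a` from the right: they are simple, and near `0` there are none. The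
zeros beyond `a` thus form a closed set, nonempty by oscillation, and the infimum is attained. -/
lemma isLeast_sInf_besselJ_zeros {ν a : ℝ} (hν : 0 < ν) (ha : 0 ≤ a) :
    IsLeast {x : ℝ | a < x ∧ besselJ ν x = 0} (sInf {x : ℝ | a < x ∧ besselJ ν x = 0}) := by
  set g : ℝ → ℝ := fun x ↦ besselF ν 1 ((x / 2) ^ 2) with hg
  have hgc : Continuous g := by
    have := continuous_besselF hν 1
    fun_prop
  have hS : {x : ℝ | a < x ∧ besselJ ν x = 0} = {x : ℝ | a < x ∧ g x = 0} := by
    ext x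
    refine and_congr_right fun hx ↦ ?_
    rw [besselJ_eq_besselF (ha.trans_lt hx)]
  have hev : ∀ᶠ x in 𝓝[>] a, g x ≠ 0 := by
    have ht : Tendsto (fun x : ℝ ↦ (x / 2) ^ 2) (𝓝[>] a) (𝓝[>] ((a / 2) ^ 2)) := by
      refine tendsto_nhdsWithin_of_tendsto_nhds_of_eventually_within _ ?_ ?_
      · exact (Continuous.tendsto (by fun_prop) a).mono_left nhdsWithin_le_nhds
      · filter_upwards [self_mem_nhdsWithin] with x hx
        have hx' : a < x := hx
        show (a / 2) ^ 2 < (x / 2) ^ 2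
        nlinarith
    exact ht.eventually (eventually_besselF_ne_zero hν (by positivity))
  obtain ⟨b, hb, hb'⟩ := (mem_nhdsGT_iff_exists_Ioo_subset).1 hev
  have hab : a < b := hb
  have hS' : {x : ℝ | a < x ∧ g x = 0} = Set.Ici b ∩ g ⁻¹' {0} := by
    ext x
    constructor
    · rintro ⟨h1, h2⟩
      exact ⟨not_lt.1 fun h ↦ hb' ⟨h1, h⟩ h2, h2⟩
    · rintro ⟨h1, h2⟩
      exact ⟨hab.trans_le h1, h2⟩
  have hbdd : BddBelow (Set.Ici b ∩ g ⁻¹' {0}) := bddBelow_Ici.mono Set.inter_subset_left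
  rw [hS, hS']
  refine ⟨(isClosed_Ici.inter (isClosed_singleton.preimage hgc)).csInf_mem ?_ hbdd,
    fun x hx ↦ csInf_le hbdd hx⟩
  obtain ⟨y, hy, hy0⟩ := exists_besselF_eq_zero hν (b ^ 2)
  have hb0 : 0 < b := ha.trans_lt hab
  have hy' : 0 < y := (by positivity : 0 < b ^ 2).trans hy
  refine ⟨2 * √y, ?_, ?_⟩
  · have := Real.lt_sqrt_of_sq_lt hy
    show b ≤ 2 * √y
    linarith
  · simp [hg, Real.sq_sqrt hy'.le, hy0]

lemma besselZero_nonneg (ν : ℝ) (k : ℕ) : 0 ≤ besselZero ν k := by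
  induction k with
  | zero => exact le_rfl
  | succ k ih => exact Real.sInf_nonneg fun x hx ↦ ih.trans hx.1.le

lemma isLeast_besselZero {ν : ℝ} (hν : 0 < ν) (k : ℕ) :
    IsLeast {x : ℝ | besselZero ν k < x ∧ besselJ ν x = 0} (besselZero ν (k + 1)) :=
  isLeast_sInf_besselJ_zeros hν (besselZero_nonneg ν k)

/-- The zeros `j_{ν,k}² / 4` of `besselG ν`, preceded by `0`. -/
noncomputable def besselT (ν : ℝ) (k : ℕ) : ℝ := (besselZero ν k / 2) ^ 2

lemma besselT_zero (ν : ℝ) : besselT ν 0 = 0 := by simp [besselT, besselZero]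

lemma strictMono_besselT {ν : ℝ} (hν : 0 < ν) : StrictMono (besselT ν) := by
  refine strictMono_nat_of_lt_succ fun k ↦ ?_
  have h1 := (isLeast_besselZero hν k).1.1
  have h2 := besselZero_nonneg ν k
  unfold besselT
  nlinarith

lemma besselT_succ_pos {ν : ℝ} (hν : 0 < ν) (k : ℕ) : 0 < besselT ν (k + 1) :=
  besselT_zero ν ▸ strictMono_besselT hν k.succ_pos

lemma besselG_besselT_succ {ν : ℝ} (hν : 0 < ν) (k : ℕ) : besselG ν (besselT ν (k + 1)) = 0 := by
  have h1 := (isLeast_besselZero hν k).1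
  exact (besselJ_eq_zero_iff ((besselZero_nonneg ν k).trans_lt h1.1)).1 h1.2

lemma besselG_ne_zero_of_mem_Ioo {ν s : ℝ} (hν : 0 < ν) {k : ℕ}
    (hs : s ∈ Set.Ioo (besselT ν k) (besselT ν (k + 1))) : besselG ν s ≠ 0 := by
  intro h
  have hs0 : 0 < s := (sq_nonneg _).trans_lt hs.1
  have hsq : (2 * √s / 2) ^ 2 = s := by
    rw [mul_div_cancel_left₀ _ two_ne_zero, Real.sq_sqrt hs0.le]
  have hpos : 0 < 2 * √s := by positivity
  have h1 : besselZero ν k < 2 * √s := by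
    have := lt_of_pow_lt_pow_left₀ 2 (by positivity) (hsq.symm ▸ hs.1)
    linarith
  have h2 := (isLeast_besselZero hν k).2 ⟨h1, (besselJ_eq_zero_iff hpos).2 (hsq.symm ▸ h)⟩
  have h3 : besselT ν (k + 1) ≤ s := by
    rw [← hsq, besselT]
    have := besselZero_nonneg ν (k + 1)
    gcongr
  exact absurd hs.2 h3.not_gt

/-! ### Picone's identity and nodal intervals. -/

/-- Picone's inequality between two consecutive zeros of a Bessel solution. -/
lemma picone_interval {u q w : ℝ → ℝ} {a μ t z z' : ℝ} (hμ : 0 < μ) (ht : 0 < t)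
    (hz : 0 ≤ z) (hzz' : z < z') (hucont : Continuous u) (hqcont : Continuous q)
    (hu : ∀ y, 0 < y → HasDerivAt u (q y / y) y)
    (hq : ∀ y, 0 < y → HasDerivAt q (a ^ 2 / y * u y - w y) y)
    (hφ : ∀ y ∈ Set.Ioo z z', besselF μ t y ≠ 0)
    (hφz : besselF μ t z = 0) (hφz' : besselF μ t z' = 0) (huz : u z = 0) (huz' : u z' = 0)
    (hint : IntervalIntegrable
      (fun y ↦ u y * (w y + ((μ / 2) ^ 2 - a ^ 2) / y * u y - t * u y)) MeasureTheory.volume z z') :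
    0 ≤ ∫ y in z..z', u y * (w y + ((μ / 2) ^ 2 - a ^ 2) / y * u y - t * u y) := by
  set φ := besselF μ t with hφdef
  set p := besselP μ t with hpdef
  have hφc : Continuous φ := continuous_besselF hμ t
  have hpc : Continuous p := continuous_besselP hμ t
  set W : ℝ → ℝ := fun y ↦ u y / φ y * (p y * u y - q y * φ y) with hW
  -- At a common positive zero, `u / φ` tends to the ratio of derivatives, finite because the zero
  -- of `φ` is simple, while the other factor tends to `0`.
  have hWpos : ∀ x, 0 < x → φ x = 0 → u x = 0 → ContinuousAt W x := fun x hx h1 h2 ↦ by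
    rw [← continuousWithinAt_compl_self]
    have hp : p x ≠ 0 := besselP_ne_zero hμ ht hx h1
    have hW0 : W x = 0 := by simp [hW, h1]
    have h3 : Tendsto (fun y ↦ slope u x y / slope φ x y) (𝓝[≠] x)
        (𝓝 ((q x / x) / (p x / x))) :=
      (hu x hx).tendsto_slope.div (hasDerivAt_besselF hμ hx).tendsto_slope
        (div_ne_zero hp hx.ne')
    have h4 : Tendsto (fun y ↦ p y * u y - q y * φ y) (𝓝[≠] x) (𝓝 0) := by
      have : Continuous fun y ↦ p y * u y - q y * φ y := by fun_prop
      have h5 := (this.tendsto x).mono_left (nhdsWithin_le_nhds (s := {x}ᶜ))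
      simpa [h1, h2] using h5
    have h6 := h3.mul h4
    rw [mul_zero] at h6
    rw [ContinuousWithinAt, hW0]
    refine h6.congr' ?_
    filter_upwards [self_mem_nhdsWithin] with y hy
    have hyx : y - x ≠ 0 := sub_ne_zero.2 hy
    rw [slope_def_field, slope_def_field, h1, h2, sub_zero, sub_zero,
      div_div_div_cancel_right₀ hyx]
  -- At the singular endpoint `u / φ` may be unbounded. In `W = (p / φ) u² - q u` the powers of `y`
  -- cancel from `p / φ`, which stays bounded.
  have hWzero : u 0 = 0 → ContinuousWithinAt W (Set.Ici 0) 0 := fun h2 ↦ by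
    rw [← continuousWithinAt_Ioi_iff_Ici]
    have hW0 : W 0 = 0 := by simp [hW, h2]
    have hg := continuous_besselG hμ
    have hg1 := continuous_besselG (ν := μ + 1) (by positivity)
    have h3 : Tendsto (fun y ↦ (μ / 2 * besselG μ (t * y) - t * y * besselG (μ + 1) (t * y)) /
        besselG μ (t * y) * u y ^ 2 - q y * u y) (𝓝[>] 0) (𝓝 0) := by
      have hc : ContinuousAt (fun y ↦ (μ / 2 * besselG μ (t * y) -
          t * y * besselG (μ + 1) (t * y)) / besselG μ (t * y) * u y ^ 2 - q y * u y) 0 := by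
        have hne : besselG μ (t * 0) ≠ 0 := by simpa using (besselG_zero_pos hμ).ne'
        refine ContinuousAt.sub (ContinuousAt.mul (ContinuousAt.div ?_ ?_ hne) ?_) ?_ <;> fun_prop
      have h5 := hc.tendsto.mono_left (nhdsWithin_le_nhds (s := Set.Ioi 0))
      simpa [h2] using h5
    rw [ContinuousWithinAt, hW0]
    refine h3.congr' ?_
    filter_upwards [self_mem_nhdsWithin, eventually_besselF_ne_zero_nhdsGT_zero hμ t]
      with y (hy : 0 < y) hy'
    have hne : besselG μ (t * y) ≠ 0 := fun h ↦ hy' ((besselF_eq_zero_iff hy).2 h)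
    have hr : y ^ (μ / 2) ≠ 0 := (Real.rpow_pos_of_pos hy _).ne'
    simp only [hW, hφdef, hpdef, besselF, besselP]
    field_simp
  have hWcont : ContinuousOn W (Set.Icc z z') := by
    intro y hy
    rcases hy.1.eq_or_lt with rfl | h1
    · rcases hz.eq_or_lt with rfl | h0
      · exact (hWzero huz).mono Set.Icc_subset_Ici_self
      · exact (hWpos _ h0 hφz huz).continuousWithinAt
    · rcases hy.2.eq_or_lt with rfl | h2
      · exact (hWpos _ (hz.trans_lt h1) hφz' huz').continuousWithinAt
      · refine ContinuousAt.continuousWithinAt ?_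
        exact (hucont.continuousAt.div hφc.continuousAt (hφ y ⟨h1, h2⟩)).mul (by fun_prop)
  -- Picone's identity: `W'` is the integrand minus a nonnegative square term. As `W` vanishes at
  -- both ends, the integral is nonnegative.
  have hWderiv : ∀ y ∈ Set.Ioo z z', HasDerivAt W
      (u y * (w y + ((μ / 2) ^ 2 - a ^ 2) / y * u y - t * u y) -
        (q y - p y * u y / φ y) ^ 2 / y) y := fun y hy ↦ by
    have hy0 : 0 < y := hz.trans_lt hy.1
    have hφy := hφ y hy
    have hφ' : HasDerivAt φ (p y / y) y := hasDerivAt_besselF hμ hy0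
    have hp' : HasDerivAt p (((μ / 2) ^ 2 / y - t) * φ y) y := hasDerivAt_besselP hμ hy0
    refine (((hu y hy0).div hφ' hφy).mul
      ((hp'.mul (hu y hy0)).sub ((hq y hy0).mul hφ'))).congr_deriv ?_
    simp only [Pi.div_apply, Pi.mul_apply, Pi.sub_apply]
    field_simp
    ring
  have hW0 : W z = 0 := by simp [hW, huz]
  have hW1 : W z' = 0 := by simp [hW, huz']
  have := intervalIntegral.sub_le_integral_of_hasDeriv_right_of_le hzz'.le hWcont
    (fun y hy ↦ (hWderiv y hy).hasDerivWithinAt)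
    ((intervalIntegrable_iff_integrableOn_Icc_of_le hzz'.le).1 hint)
    (fun y hy ↦ by
      have hy0 : 0 < y := hz.trans_lt hy.1
      have : 0 ≤ (q y - p y * u y / φ y) ^ 2 / y := by positivity
      linarith)
  linarith

/-- Picone's inequality on `[0, 1]` for a function vanishing at the zeros of a Bessel solution. -/
lemma picone_unit_interval {u q w : ℝ → ℝ} {a μ : ℝ} (hμ : 0 < μ) (j : ℕ)
    (hucont : Continuous u) (hqcont : Continuous q)
    (hu : ∀ y, 0 < y → HasDerivAt u (q y / y) y)
    (hq : ∀ y, 0 < y → HasDerivAt q (a ^ 2 / y * u y - w y) y)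
    (huz : ∀ i ≤ j + 1, u (besselT μ i / besselT μ (j + 1)) = 0)
    (hint : IntervalIntegrable (fun y ↦ u y * (w y + ((μ / 2) ^ 2 - a ^ 2) / y * u y -
      besselT μ (j + 1) * u y)) MeasureTheory.volume 0 1) :
    0 ≤ ∫ y in (0 : ℝ)..1, u y * (w y + ((μ / 2) ^ 2 - a ^ 2) / y * u y -
      besselT μ (j + 1) * u y) := by
  set t := besselT μ (j + 1) with ht
  have ht0 : 0 < t := besselT_succ_pos hμ j
  -- The nodes of `besselF μ t`, rescaled so that the last one is `1`.
  set z : ℕ → ℝ := fun i ↦ besselT μ i / t with hz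
  have hzm : StrictMono z := fun a b hab ↦ div_lt_div_of_pos_right (strictMono_besselT hμ hab) ht0
  have hz0 : z 0 = 0 := by simp [hz, besselT_zero]
  have hz1 : z (j + 1) = 1 := div_self ht0.ne'
  have hφ : ∀ i, besselF μ t (z i) = 0 := fun i ↦ by
    cases i with
    | zero => rw [hz0, besselF_apply_zero hμ]
    | succ i =>
      rw [besselF_eq_zero_iff (div_pos (besselT_succ_pos hμ i) ht0), mul_div_cancel₀ _ ht0.ne',
        besselG_besselT_succ hμ]
  have hzle : ∀ i < j + 1, IntervalIntegrable (fun y ↦ u y * (w y + ((μ / 2) ^ 2 - a ^ 2) / y * u y -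
      t * u y)) MeasureTheory.volume (z i) (z (i + 1)) := fun i hi ↦ by
    refine hint.mono_set ?_
    rw [Set.uIcc_of_le (hzm i.lt_succ_self).le, Set.uIcc_of_le zero_le_one]
    refine Set.Icc_subset_Icc (hz0 ▸ hzm.monotone i.zero_le) (hz1 ▸ hzm.monotone hi)
  have hsum := intervalIntegral.sum_integral_adjacent_intervals hzle
  rw [hz0, hz1] at hsum
  rw [← hsum]
  refine Finset.sum_nonneg fun i hi ↦ ?_
  have hi' : i < j + 1 := Finset.mem_range.1 hi
  have hzi : 0 ≤ z i := hz0 ▸ hzm.monotone i.zero_le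
  refine picone_interval hμ ht0 hzi (hzm i.lt_succ_self) hucont hqcont hu hq ?_ (hφ i)
    (hφ (i + 1)) (huz i hi'.le) (huz (i + 1) hi') (hzle i hi')
  intro y hy
  rw [Ne, besselF_eq_zero_iff (hzi.trans_lt hy.1)]
  refine besselG_ne_zero_of_mem_Ioo hμ (k := i) ⟨?_, ?_⟩
  · exact (div_lt_iff₀' ht0).1 hy.1
  · exact (lt_div_iff₀' ht0).1 hy.2

/-! ### Orthogonality and integrability of the eigenfunctions. -/

lemma integral_besselF_mul_eq_zero {ν s t : ℝ} (hν : 0 < ν) (hs : besselG ν s = 0)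
    (ht : besselG ν t = 0) (hst : s ≠ t) :
    ∫ y in (0 : ℝ)..1, besselF ν s y * besselF ν t y = 0 := by
  have c1 := continuous_besselF hν s
  have c2 := continuous_besselF hν t
  have c3 := continuous_besselP hν s
  have c4 := continuous_besselP hν t
  -- Lagrange's identity: the Wronskian vanishes at both endpoints, and its derivative is `(t - s)`
  -- times the product.
  have h := intervalIntegral.integral_eq_sub_of_hasDerivAt_of_le zero_le_one
    (f := fun y ↦ besselP ν s y * besselF ν t y - besselP ν t y * besselF ν s y)
    (f' := fun y ↦ (t - s) * (besselF ν s y * besselF ν t y))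
    (by fun_prop)
    (fun y hy ↦ by
      have d1 := hasDerivAt_besselF (t := s) hν hy.1
      have d2 := hasDerivAt_besselF (t := t) hν hy.1
      have d3 := hasDerivAt_besselP (t := s) hν hy.1
      have d4 := hasDerivAt_besselP (t := t) hν hy.1
      refine ((d3.mul d2).sub (d4.mul d1)).congr_deriv ?_
      ring)
    ((by fun_prop : Continuous fun y ↦
      (t - s) * (besselF ν s y * besselF ν t y)).intervalIntegrable _ _)
  have e1 : besselF ν s 1 = 0 := by rw [besselF_eq_zero_iff one_pos, mul_one, hs]
  have e2 : besselF ν t 1 = 0 := by rw [besselF_eq_zero_iff one_pos, mul_one, ht]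
  rw [intervalIntegral.integral_const_mul, e1, e2, besselF_apply_zero hν,
    besselF_apply_zero hν] at h
  simpa [sub_ne_zero.2 hst.symm] using h

lemma integral_besselF_sq_pos {ν : ℝ} (hν : 0 < ν) (t : ℝ) :
    0 < ∫ y in (0 : ℝ)..1, besselF ν t y * besselF ν t y := by
  have c1 := continuous_besselF hν t
  obtain ⟨y, hy, hy'⟩ := ((eventually_besselF_ne_zero_nhdsGT_zero hν t).and
    (Ioo_mem_nhdsGT one_pos)).exists
  exact intervalIntegral.integral_pos one_pos (by fun_prop) (fun x _ ↦ mul_self_nonneg _)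
    ⟨y, Set.Ioo_subset_Icc_self hy', mul_self_pos.2 hy⟩

lemma intervalIntegrable_besselF_mul_div {ν : ℝ} (hν : 0 < ν) (s t : ℝ) :
    IntervalIntegrable (fun y ↦ besselF ν s y * besselF ν t y / y) MeasureTheory.volume 0 1 := by
  have c1 := continuous_besselG hν
  have h : IntervalIntegrable (fun y : ℝ ↦ y ^ (ν - 1) * (besselG ν (s * y) * besselG ν (t * y)))
      MeasureTheory.volume 0 1 :=
    (intervalIntegral.intervalIntegrable_rpow' (by linarith)).mul_continuousOn (by fun_prop)
  refine h.congr ?_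
  intro y hy
  have hy0 : 0 < y := by rw [Set.uIoc_of_le zero_le_one] at hy; exact hy.1
  have hr : y ^ ν = y ^ (ν / 2) * y ^ (ν / 2) := by rw [← Real.rpow_add hy0, add_halves]
  simp only [besselF]
  rw [Real.rpow_sub_one hy0.ne', hr]
  ring

/-! ### Finite-dimensional min-max. -/

/-- Lower bounds on the eigenvalues of a symmetric operator by the min-max principle, summed up. -/
lemma sum_le_trace_of_minmax {E : Type*} [NormedAddCommGroup E] [InnerProductSpace ℝ E]
    [FiniteDimensional ℝ E] {m : ℕ} (hm : Module.finrank ℝ E = m) {A : E →ₗ[ℝ] E}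
    (hA : A.IsSymmetric) (τ : Fin m → ℝ)
    (h : ∀ j : Fin m, ∃ v : Fin j → E, ∀ x, (∀ i, inner ℝ (v i) x = 0) →
      τ j * inner ℝ x x ≤ inner ℝ x (A x)) :
    ∑ j, τ j ≤ A.trace ℝ E := by
  -- `eigenvalues` is decreasing, so `Fin.rev` lists the eigenvalues from the lowest up.
  have htr : A.trace ℝ E = ∑ j : Fin m, hA.eigenvalues hm (Fin.rev j) := by
    rw [A.trace_eq_sum_inner (hA.eigenvectorBasis hm), ← Equiv.sum_comp Fin.revPerm]
    refine Finset.sum_congr rfl fun i _ ↦ ?_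
    rw [hA.apply_eigenvectorBasis, inner_smul_right, real_inner_self_eq_norm_sq,
      (hA.eigenvectorBasis hm).orthonormal.1 _]
    simp
  rw [htr]
  refine Finset.sum_le_sum fun j _ ↦ ?_
  obtain ⟨v, hv⟩ := h j
  let e : Fin (j + 1) → E := fun i ↦ hA.eigenvectorBasis hm (Fin.rev (Fin.castLE j.2 i))
  let lam : Fin (j + 1) → ℝ := fun i ↦ hA.eigenvalues hm (Fin.rev (Fin.castLE j.2 i))
  have he : Orthonormal ℝ e := (hA.eigenvectorBasis hm).orthonormal.comp _
    (Fin.rev_injective.comp (Fin.castLE_injective j.2))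
  let Φ : (Fin (j + 1) → ℝ) →ₗ[ℝ] (Fin j → ℝ) :=
    LinearMap.pi fun i ↦ (innerₗ E (v i)) ∘ₗ Fintype.linearCombination ℝ e
  -- The span of the `j + 1` lowest eigenvectors meets the `j` conditions in a nonzero vector, whose
  -- Rayleigh quotient is at most the eigenvalue of index `j`.
  obtain ⟨c, hc, hc0⟩ := (Submodule.ne_bot_iff _).1
    (Φ.ker_ne_bot_of_finrank_lt (by simp))
  set x : E := ∑ i, c i • e i with hx
  have hAx : A x = ∑ i, (c i * lam i) • e i := by
    rw [hx, map_sum]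
    refine Finset.sum_congr rfl fun i _ ↦ ?_
    rw [map_smul, hA.apply_eigenvectorBasis, smul_smul]
    rfl
  have hxx : inner ℝ x x = ∑ i, c i * c i := by
    rw [hx, he.inner_sum]; simp
  have hxA : inner ℝ x (A x) = ∑ i, c i * (c i * lam i) := by
    rw [hAx, hx, he.inner_sum]; simp
  have hle : inner ℝ x (A x) ≤ hA.eigenvalues hm (Fin.rev j) * inner ℝ x x := by
    rw [hxA, hxx, Finset.mul_sum]
    refine Finset.sum_le_sum fun i _ ↦ ?_
    have h1 : lam i ≤ hA.eigenvalues hm (Fin.rev j) := by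
      refine hA.eigenvalues_antitone hm (Fin.rev_le_rev.2 ?_)
      exact Fin.mk_le_of_le_val (Nat.le_of_lt_succ i.2)
    nlinarith [mul_self_nonneg (c i)]
  have hpos : 0 < inner ℝ x x := by
    rw [hxx]
    obtain ⟨i, hi⟩ := Function.ne_iff.1 hc0
    exact Finset.sum_pos' (fun i _ ↦ mul_self_nonneg _)
      ⟨i, Finset.mem_univ i, mul_self_pos.2 hi⟩
  have hker : ∀ i, inner ℝ (v i) x = 0 := fun i ↦ congrFun (LinearMap.mem_ker.1 hc) i
  exact le_of_mul_le_mul_right ((hv x hker).trans hle) hpos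

/-! ### The form of order `μ` on eigenfunctions of order `ν`. -/

/-- The normalized eigenfunction with eigenvalue `besselT ν (k + 1)`. -/
noncomputable def besselU (ν : ℝ) (k : ℕ) (y : ℝ) : ℝ :=
  (√(∫ s in (0 : ℝ)..1, besselF ν (besselT ν (k + 1)) s * besselF ν (besselT ν (k + 1)) s))⁻¹ *
    besselF ν (besselT ν (k + 1)) y

/-- The quasi-derivative of `besselU`. -/
noncomputable def besselV (ν : ℝ) (k : ℕ) (y : ℝ) : ℝ :=
  (√(∫ s in (0 : ℝ)..1, besselF ν (besselT ν (k + 1)) s * besselF ν (besselT ν (k + 1)) s))⁻¹ *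
    besselP ν (besselT ν (k + 1)) y

lemma continuous_besselU {ν : ℝ} (hν : 0 < ν) (k : ℕ) : Continuous (besselU ν k) :=
  continuous_const.mul (continuous_besselF hν _)

lemma continuous_besselV {ν : ℝ} (hν : 0 < ν) (k : ℕ) : Continuous (besselV ν k) :=
  continuous_const.mul (continuous_besselP hν _)

lemma hasDerivAt_besselU {ν : ℝ} (hν : 0 < ν) (k : ℕ) {y : ℝ} (hy : 0 < y) :
    HasDerivAt (besselU ν k) (besselV ν k y / y) y :=
  ((hasDerivAt_besselF hν hy).const_mul _).congr_deriv (by rw [besselV]; ring)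

lemma hasDerivAt_besselV {ν : ℝ} (hν : 0 < ν) (k : ℕ) {y : ℝ} (hy : 0 < y) :
    HasDerivAt (besselV ν k)
      ((ν / 2) ^ 2 / y * besselU ν k y - besselT ν (k + 1) * besselU ν k y) y :=
  ((hasDerivAt_besselP hν hy).const_mul _).congr_deriv (by rw [besselU]; ring)

lemma besselU_zero {ν : ℝ} (hν : 0 < ν) (k : ℕ) : besselU ν k 0 = 0 := by
  rw [besselU, besselF_apply_zero hν, mul_zero]

lemma besselU_one {ν : ℝ} (hν : 0 < ν) (k : ℕ) : besselU ν k 1 = 0 := by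
  rw [besselU, (besselF_eq_zero_iff one_pos).2 (by rw [mul_one, besselG_besselT_succ hν]),
    mul_zero]

lemma integral_besselU_mul {ν : ℝ} (hν : 0 < ν) (j k : ℕ) :
    ∫ y in (0 : ℝ)..1, besselU ν j y * besselU ν k y = if j = k then 1 else 0 := by
  have h : ∀ y, besselU ν j y * besselU ν k y = _ * (besselF ν _ y * besselF ν _ y) :=
    fun y ↦ mul_mul_mul_comm _ _ _ _
  simp only [h, intervalIntegral.integral_const_mul]
  split_ifs with hjk
  · subst hjk
    have h1 := integral_besselF_sq_pos hν (besselT ν (j + 1))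
    rw [← mul_inv, Real.mul_self_sqrt h1.le, inv_mul_cancel₀ h1.ne']
  · rw [integral_besselF_mul_eq_zero hν (besselG_besselT_succ hν j) (besselG_besselT_succ hν k)
      (fun h ↦ hjk (by simpa using (strictMono_besselT hν).injective h)), mul_zero]

lemma intervalIntegrable_besselU_mul_div {ν : ℝ} (hν : 0 < ν) (j k : ℕ) :
    IntervalIntegrable (fun y ↦ besselU ν j y * besselU ν k y / y) MeasureTheory.volume 0 1 := by
  refine ((intervalIntegrable_besselF_mul_div hν (besselT ν (j + 1)) (besselT ν (k + 1))).const_mul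
    ((√(∫ s in (0 : ℝ)..1, besselF ν (besselT ν (j + 1)) s * besselF ν (besselT ν (j + 1)) s))⁻¹ *
    (√(∫ s in (0 : ℝ)..1, besselF ν (besselT ν (k + 1)) s *
      besselF ν (besselT ν (k + 1)) s))⁻¹)).congr fun y _ ↦ ?_
  simp only [besselU]; ring

/-- The matrix of the form of order `μ` in the eigenfunctions of order `ν`. -/
noncomputable def besselMatrix (ν μ : ℝ) (m : ℕ) : Matrix (Fin m) (Fin m) ℝ := fun j k ↦
  (if j = k then besselT ν (k + 1) else 0) + ((μ / 2) ^ 2 - (ν / 2) ^ 2) *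
    ∫ y in (0 : ℝ)..1, besselU ν j y * besselU ν k y / y

lemma isHermitian_besselMatrix (ν μ : ℝ) (m : ℕ) : (besselMatrix ν μ m).IsHermitian := by
  ext j k
  simp only [Matrix.conjTranspose_apply, besselMatrix, star_trivial]
  congr 1
  · by_cases h : j = k
    · simp [h]
    · simp [h, Ne.symm h]
  · simp only [mul_comm (besselU ν k _)]

/-- Changing the order from `ν` to `μ` only adds the potential `((μ / 2)² - (ν / 2)²) / y`, so by
orthonormality the quadratic form is that of `besselMatrix`, shifted by `t`. -/
lemma hasIntegral_besselU_form {ν μ : ℝ} (hν : 0 < ν) {m : ℕ} (t : ℝ) (x : Fin m → ℝ) :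
    IntervalIntegrable (fun y ↦ (∑ k, x k * besselU ν k y) *
      ((∑ k, x k * (besselT ν (k + 1) * besselU ν k y)) +
        ((μ / 2) ^ 2 - (ν / 2) ^ 2) / y * (∑ k, x k * besselU ν k y) -
        t * (∑ k, x k * besselU ν k y))) MeasureTheory.volume 0 1 ∧
    ∫ y in (0 : ℝ)..1, (∑ k, x k * besselU ν k y) *
      ((∑ k, x k * (besselT ν (k + 1) * besselU ν k y)) +
        ((μ / 2) ^ 2 - (ν / 2) ^ 2) / y * (∑ k, x k * besselU ν k y) -
        t * (∑ k, x k * besselU ν k y)) =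
      (∑ j, x j * ∑ k, besselMatrix ν μ m j k * x k) - t * ∑ j, x j * x j := by
  set c := (μ / 2) ^ 2 - (ν / 2) ^ 2 with hc
  have hU := fun k ↦ continuous_besselU hν k
  have hexp : ∀ y, (∑ k, x k * besselU ν k y) *
      ((∑ k, x k * (besselT ν (k + 1) * besselU ν k y)) +
        c / y * (∑ k, x k * besselU ν k y) - t * (∑ k, x k * besselU ν k y)) =
      ∑ j : Fin m, ∑ k : Fin m, (x j * x k * (besselT ν (k + 1) - t) *
        (besselU ν j y * besselU ν k y) +
          x j * x k * c * (besselU ν j y * besselU ν k y / y)) := fun y ↦ by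
    rw [Finset.mul_sum, Finset.mul_sum, ← Finset.sum_add_distrib, ← Finset.sum_sub_distrib,
      Finset.sum_mul_sum]
    refine Finset.sum_congr rfl fun j _ ↦ Finset.sum_congr rfl fun k _ ↦ ?_
    ring
  have hi1 : ∀ j k : Fin m, IntervalIntegrable (fun y ↦ x j * x k * (besselT ν (k + 1) - t) *
      (besselU ν j y * besselU ν k y)) MeasureTheory.volume 0 1 := fun j k ↦
    (continuous_const.mul ((hU j).mul (hU k))).intervalIntegrable _ _
  have hi2 : ∀ j k : Fin m, IntervalIntegrable (fun y ↦ x j * x k * c *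
      (besselU ν j y * besselU ν k y / y)) MeasureTheory.volume 0 1 := fun j k ↦
    (intervalIntegrable_besselU_mul_div hν j k).const_mul _
  have hsum : ∀ {f : Fin m → ℝ → ℝ}, (∀ k, IntervalIntegrable (f k) MeasureTheory.volume 0 1) →
      IntervalIntegrable (fun y ↦ ∑ k, f k y) MeasureTheory.volume 0 1 := fun h ↦ by
    simpa only [Finset.sum_fn] using IntervalIntegrable.sum Finset.univ fun k _ ↦ h k
  simp only [hexp]
  have hi3 : ∀ j : Fin m, IntervalIntegrable (fun y ↦ ∑ k : Fin m,
      (x j * x k * (besselT ν (k + 1) - t) * (besselU ν j y * besselU ν k y) +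
          x j * x k * c * (besselU ν j y * besselU ν k y / y))) MeasureTheory.volume 0 1 := fun j ↦
    hsum fun k ↦ (hi1 j k).add (hi2 j k)
  refine ⟨hsum hi3, ?_⟩
  rw [intervalIntegral.integral_finsetSum fun j _ ↦ hi3 j, Finset.mul_sum,
    ← Finset.sum_sub_distrib]
  refine Finset.sum_congr rfl fun j _ ↦ ?_
  rw [intervalIntegral.integral_finsetSum fun k _ ↦ (hi1 j k).add (hi2 j k), Finset.mul_sum]
  have hd : t * (x j * x j) = ∑ k, if j = k then t * (x j * x k) else 0 := by simp
  rw [hd, ← Finset.sum_sub_distrib]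
  refine Finset.sum_congr rfl fun k _ ↦ ?_
  rw [intervalIntegral.integral_add (hi1 j k) (hi2 j k), intervalIntegral.integral_const_mul,
    intervalIntegral.integral_const_mul, integral_besselU_mul hν, besselMatrix, ← hc]
  simp only [Fin.val_inj]
  split_ifs <;> ring

lemma sum_besselT_le_trace {ν μ : ℝ} (hν : 0 < ν) (hμ : 0 < μ) (m : ℕ) :
    ∑ k : Fin m, besselT μ (k + 1) ≤ (besselMatrix ν μ m).trace := by
  have hT := Matrix.isSymmetric_toEuclideanLin_iff.2 (isHermitian_besselMatrix ν μ m)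
  have htr : (besselMatrix ν μ m).toEuclideanLin.trace ℝ (EuclideanSpace ℝ (Fin m)) =
      (besselMatrix ν μ m).trace := by
    rw [LinearMap.trace_eq_sum_inner _ (EuclideanSpace.basisFun (Fin m) ℝ)]
    refine Finset.sum_congr rfl fun i _ ↦ ?_
    simp [Matrix.toLpLin_apply, EuclideanSpace.inner_single_left]
  rw [← htr]
  -- The vectors `v i` encode the values of the trial function at the interior nodes; it vanishes at
  -- `0` and `1` automatically.
  refine sum_le_trace_of_minmax finrank_euclideanSpace_fin hT _ fun j ↦
    ⟨fun i ↦ WithLp.toLp 2 fun k : Fin m ↦ besselU ν k (besselT μ (i + 1) / besselT μ (j + 1)),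
      fun x hx ↦ ?_⟩
  obtain ⟨hint, hval⟩ := hasIntegral_besselU_form (μ := μ) hν (besselT μ (j + 1)) x
  have hpic := picone_unit_interval (a := ν / 2) (q := fun y ↦ ∑ k : Fin m, x k * besselV ν k y)
    (u := fun y ↦ ∑ k : Fin m, x k * besselU ν k y) hμ j
    (continuous_finsetSum _ fun k _ ↦ continuous_const.mul (continuous_besselU hν k))
    (continuous_finsetSum _ fun k _ ↦ continuous_const.mul (continuous_besselV hν k))
    (fun y hy ↦ by
      rw [Finset.sum_div]
      exact HasDerivAt.fun_sum fun k _ ↦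
        ((hasDerivAt_besselU hν k hy).const_mul (x k)).congr_deriv (by ring))
    (fun y hy ↦ by
      rw [Finset.mul_sum, ← Finset.sum_sub_distrib]
      exact HasDerivAt.fun_sum fun k _ ↦
        ((hasDerivAt_besselV hν k hy).const_mul (x k)).congr_deriv (by ring))
    (fun i hi ↦ by
      rcases i with _ | i
      · simp [besselT_zero, besselU_zero hν]
      rcases (Nat.le_of_succ_le_succ hi).eq_or_lt with rfl | hi'
      · rw [div_self (besselT_succ_pos hμ _).ne']
        simp [besselU_one hν]
      · simpa [PiLp.inner_apply, mul_comm] using hx ⟨i, hi'⟩) hint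
  rw [hval] at hpic
  have h1 : inner ℝ x x = ∑ j, x j * x j := PiLp.inner_apply x x
  have h2 : inner ℝ x ((besselMatrix ν μ m).toEuclideanLin x) =
      ∑ j, x j * ∑ k, besselMatrix ν μ m j k * x k := by
    simp [PiLp.inner_apply, Matrix.toLpLin_apply, Matrix.mulVec, dotProduct, mul_comm]
  rw [h1, h2]
  linarith

/-! ### Concavity in the squared order. -/

/-- A supergradient inequality: `∑ k ≤ m, j_{μ,k}²` is a concave function of `μ²`. -/
lemma exists_supergradient_sum_besselE {ν : ℝ} (hν : 0 < ν) (m : ℕ) :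
    ∃ G : ℝ, ∀ μ, 0 < μ →
      ∑ k ∈ Finset.Icc 1 m, (besselE k μ - besselE k ν) ≤ (μ ^ 2 - ν ^ 2) * G := by
  -- The first-order change of the trace with respect to `ν²`: the factor `4` in `E_k = 4 τ_k`
  -- cancels the one in `(μ² - ν²) / 4`.
  refine ⟨∑ k : Fin m, ∫ y in (0 : ℝ)..1, besselU ν k y * besselU ν k y / y, fun μ hμ ↦ ?_⟩
  have h := sum_besselT_le_trace hν hμ m
  have hE : ∀ (κ : ℝ), ∑ k ∈ Finset.Icc 1 m, besselE k κ = 4 * ∑ k : Fin m, besselT κ (k + 1) :=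
    fun κ ↦ by
      rw [Fin.sum_univ_eq_sum_range (fun k ↦ besselT κ (k + 1)), Finset.mul_sum,
        Finset.range_eq_Ico, Finset.sum_Ico_add' (fun k ↦ 4 * besselT κ k)]
      refine Finset.sum_congr (by ext; simp) fun k _ ↦ ?_
      rw [besselE, besselT]; ring
  have htr : (besselMatrix ν μ m).trace = ∑ k : Fin m, besselT ν (k + 1) +
      ((μ / 2) ^ 2 - (ν / 2) ^ 2) *
        ∑ k : Fin m, ∫ y in (0 : ℝ)..1, besselU ν k y * besselU ν k y / y := by
    simp [Matrix.trace, besselMatrix, Finset.sum_add_distrib, Finset.mul_sum]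
  rw [htr] at h
  rw [Finset.sum_sub_distrib, hE, hE]
  linarith

theorem mainTheorem11 (ν₁ ν ν₂ : ℝ) (hν₁ : 0 < ν₁) (hν₁ν : ν₁ < ν) (hνν₂ : ν < ν₂)
    (m : ℕ) (hm : 0 < m) :
    -- the zeros exist: each `j_{μ,k+1}` is the smallest zero of `J_μ` beyond `j_{μ,k}`
    (∀ μ : ℝ, 0 < μ → ∀ k : ℕ,
      IsLeast {x : ℝ | besselZero μ k < x ∧ besselJ μ x = 0} (besselZero μ (k + 1))) ∧
    ∑ k ∈ Finset.Icc 1 m, (besselE k ν₂ - besselE k ν) ≤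
      (ν₂ ^ 2 - ν ^ 2) / (ν ^ 2 - ν₁ ^ 2) *
        ∑ k ∈ Finset.Icc 1 m, (besselE k ν - besselE k ν₁) := by
  refine ⟨fun μ hμ k ↦ isLeast_besselZero hμ k, ?_⟩
  obtain ⟨G, hG⟩ := exists_supergradient_sum_besselE (hν₁.trans hν₁ν) m
  have h1 := hG ν₁ hν₁
  have h2 := hG ν₂ (hν₁.trans (hν₁ν.trans hνν₂))
  have hd1 : 0 < ν ^ 2 - ν₁ ^ 2 := by nlinarith
  have hd2 : 0 < ν₂ ^ 2 - ν ^ 2 := by nlinarith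
  -- At `μ = ν₁` the factor `ν₁² - ν²` is negative, so the supergradient inequality bounds `G` above
  -- by the left slope.
  have h3 : G ≤ (∑ k ∈ Finset.Icc 1 m, (besselE k ν - besselE k ν₁)) / (ν ^ 2 - ν₁ ^ 2) := by
    rw [le_div_iff₀ hd1]
    rw [Finset.sum_sub_distrib] at h1 ⊢
    linarith
  calc _ ≤ (ν₂ ^ 2 - ν ^ 2) * G := h2
    _ ≤ (ν₂ ^ 2 - ν ^ 2) *
        ((∑ k ∈ Finset.Icc 1 m, (besselE k ν - besselE k ν₁)) / (ν ^ 2 - ν₁ ^ 2)) := by gcongr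
    _ = _ := by ring
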